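/- Let $G=(V,E)$ be an infinite, connected, locally finite (simple) graph. Let $\mathrm{Aut}(G)$ be the group of bijections of $V$ that preserve adjacency and non-adjacency, with the topology of pointwise convergence on $V$ (where $V$ is discrete). Suppose that $G$ is quasi-transitive, i.e. there is a finite set $S\subset V$ such that every $y\in V$ is of the form $\gamma x$ with $\gamma\in\mathrm{Aut}(G)$ and $x\in S$, and amenable, i.e. \[ \inf_{W}\frac{|\partial W|}{|W|}=0,\qquad \partial W:=\{x\in W:\ \exists y\in V\setminus W \text{ with } \{x,y\}\in E\}, \] where $W$ ranges over the finite nonempty subsets of $V$. Then: (i) $\mathrm{Aut}(G)$ is a locally compact group that is amenable, i.e. for a left Haar measure there is a positive linear functional $m$ on $L^\infty(\mathrm{Aut}(G))$ with $m(1)=1$ that is invariant under left translations; (ii) $\mathrm{Aut}(G)$ is unimodular, i.e. its left Haar measures are also right-invariant; (iii) $\mathrm{Aut}(G)$ is generated by a compact subset; (iv) $\mathrm{Aut}(G)$ is not the union of an increasing sequence $\Gamma_1\subseteq\Gamma_2\subseteq\cdots$ of compact proper subgroups. -/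

import Mathlib

open MeasureTheory
open scoped ENNReal

/-- The inner vertex boundary of `W`: the vertices of `W` that have a neighbour outside `W`. -/
def SimpleGraph.innerBoundary {V : Type*} (G : SimpleGraph V) (W : Set V) : Set V :=
  {x | x ∈ W ∧ ∃ y, y ∉ W ∧ G.Adj x y}

/-- An infinite graph is amenable if the infimum of `|∂W| / |W|` over the finite nonempty sets `W`
of vertices is zero. -/
structure SimpleGraph.IsAmenable {V : Type*} (G : SimpleGraph V) : Prop where
  infinite : Infinite V
  iInf_eq_zero : (⨅ W : {W : Finset V // W.Nonempty},
    ((G.innerBoundary (W.1 : Set V)).ncard : ℝ) / (W.1.card : ℝ)) = 0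

/-- Quasi-transitivity: some finite set of vertices meets every orbit of the automorphism group. -/
def SimpleGraph.IsQuasiTransitive {V : Type*} (G : SimpleGraph V) : Prop :=
  ∃ S : Finset V, ∀ y : V, ∃ γ : G ≃g G, ∃ x ∈ S, γ x = y

/-- The topology of pointwise convergence on the automorphism group: the coarsest topology for
which all the evaluation maps `γ ↦ γ x` into the discrete space `V` are continuous. -/
instance SimpleGraph.autTopology {V : Type*} (G : SimpleGraph V) : TopologicalSpace (G ≃g G) :=
  ⨅ x : V, TopologicalSpace.induced (fun γ : G ≃g G => γ x) ⊥

theorem SimpleGraph.continuous_aut_iff {V : Type*} (G : SimpleGraph V) {X : Type*}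
    [TopologicalSpace X] (f : X → (G ≃g G)) :
    Continuous f ↔ ∀ (x y : V), IsOpen {a : X | f a x = y} := by
  letI : TopologicalSpace V := ⊥
  haveI : DiscreteTopology V := ⟨rfl⟩
  rw [continuous_iInf_rng]
  refine forall_congr' fun x => ?_
  rw [continuous_induced_rng, continuous_discrete_rng]
  exact Iff.rfl

theorem SimpleGraph.isOpen_aut_apply_eq {V : Type*} (G : SimpleGraph V) (x y : V) :
    IsOpen {γ : G ≃g G | γ x = y} :=
  (G.continuous_aut_iff id).1 continuous_id x y

instance SimpleGraph.aut_isTopologicalGroup {V : Type*} (G : SimpleGraph V) :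
    IsTopologicalGroup (G ≃g G) where
  continuous_mul := by
    rw [G.continuous_aut_iff]
    intro x y
    have : {a : (G ≃g G) × (G ≃g G) | (a.1 * a.2) x = y} =
        ⋃ z : V, {γ : G ≃g G | γ z = y} ×ˢ {γ : G ≃g G | γ x = z} := by
      ext a
      simp [RelIso.mul_apply]
    rw [this]
    exact isOpen_iUnion fun z => (G.isOpen_aut_apply_eq z y).prod (G.isOpen_aut_apply_eq x z)
  continuous_inv := by
    rw [G.continuous_aut_iff]
    intro x y
    have : {a : G ≃g G | a⁻¹ x = y} = {γ : G ≃g G | γ y = x} := by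
      ext a
      constructor
      · rintro rfl
        exact RelIso.apply_inv_self a x
      · rintro rfl
        exact RelIso.inv_apply_self a y
    rw [this]
    exact G.isOpen_aut_apply_eq y x

instance SimpleGraph.autMeasurableSpace {V : Type*} (G : SimpleGraph V) :
    MeasurableSpace (G ≃g G) :=
  borel _

instance SimpleGraph.aut_borelSpace {V : Type*} (G : SimpleGraph V) : BorelSpace (G ≃g G) :=
  ⟨rfl⟩

/-- A left-invariant mean on `L^∞(Γ, μ)`: a positive normalized linear functional that takes the
same value on `f` and on its left translates `x ↦ f (g * x)`. -/
structure IsLeftInvariantMean {Γ : Type*} [Group Γ] [TopologicalSpace Γ] [IsTopologicalGroup Γ]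
    [MeasurableSpace Γ] [BorelSpace Γ] (μ : Measure Γ) [μ.IsMulLeftInvariant]
    (m : Lp ℝ ∞ μ →ₗ[ℝ] ℝ) : Prop where
  nonneg : ∀ f : Lp ℝ ∞ μ, 0 ≤ f → 0 ≤ m f
  map_one : m ((memLp_top_const (1 : ℝ)).toLp (fun _ : Γ => (1 : ℝ))) = 1
  map_translate : ∀ (g : Γ) (f : Lp ℝ ∞ μ), m (DomMulAct.mk g • f) = m f

/-- Amenability of a locally compact group: there is a left-invariant mean on `L^∞` of (any)
left Haar measure. -/
structure IsAmenableGroup (Γ : Type*) [Group Γ] [TopologicalSpace Γ] [IsTopologicalGroup Γ]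
    [MeasurableSpace Γ] [BorelSpace Γ] : Prop where
  locallyCompact : LocallyCompactSpace Γ
  exists_mean : ∀ (μ : Measure Γ) [μ.IsHaarMeasure] [μ.Regular],
    ∃ m : Lp ℝ ∞ μ →ₗ[ℝ] ℝ, IsLeftInvariantMean μ m

/-- Unimodularity of a locally compact group: left Haar measures are right-invariant. -/
structure IsUnimodularGroup (Γ : Type*) [Group Γ] [TopologicalSpace Γ] [IsTopologicalGroup Γ]
    [MeasurableSpace Γ] [BorelSpace Γ] : Prop where
  locallyCompact : LocallyCompactSpace Γ
  right_invariant : ∀ (μ : Measure Γ) [μ.IsHaarMeasure] [μ.Regular], μ.IsMulRightInvariant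

/-! Vertex stabilizers are compact and open, since an automorphism with one prescribed value has
only finitely many choices at every other vertex. Fix `o` and a left Haar measure. By left
invariance the automorphisms taking `o` into a finite set `T` have measure `|T ∩ orbit o|` times
that of the stabilizer of `o`. Unimodularity: if `γ o ∈ W` but `γ (δ o) ∉ W`, then `γ o` lies near
the complement of `W`. For Følner sets `W` this is rare, so the stabilizers of `o` and `δ o`, which
are conjugate, have equal measure (`measureReal_stabilizer_eq`), and the modular function is
trivial. Amenability: the sets `{γ | γ⁻¹ o ∈ W}` form a Følner sequence, because left translation by
`δ` only replaces `o` by `δ o`. Unimodularity is what allows counting with `γ⁻¹`. Compact generation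
comes from following paths in the graph; the last claim then follows from Baire's theorem. -/

namespace SimpleGraph

variable {V : Type*} (G : SimpleGraph V)

/-! ### Compact open stabilizers and compact generation. -/

theorem Connected.dist_aut {G : SimpleGraph V} (hconn : G.Connected) (γ : G ≃g G) (x y : V) :
    G.dist (γ x) (γ y) = G.dist x y := by
  have key : ∀ (δ : G ≃g G) (a b : V), G.dist (δ a) (δ b) ≤ G.dist a b := by
    intro δ a b
    obtain ⟨p, hp⟩ := hconn.exists_walk_length_eq_dist a b
    rw [← hp, ← Walk.length_map δ.toHom p]
    exact dist_le (p.map δ.toHom)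
  refine le_antisymm (key γ x y) ?_
  simpa [RelIso.inv_apply_self] using key γ⁻¹ (γ x) (γ y)

theorem Connected.finite_setOf_dist_le {G : SimpleGraph V} [G.LocallyFinite]
    (hconn : G.Connected) (x : V) (R : ℕ) : {y | G.dist x y ≤ R}.Finite := by
  induction R with
  | zero =>
    refine (Set.finite_singleton x).subset fun y hy => ?_
    exact (hconn.dist_eq_zero_iff.1 (Nat.le_zero.1 hy)).symm
  | succ R ih =>
    refine ((ih.biUnion fun y _ => ((G.neighborSet y).toFinite.insert y)).subset fun y hy => ?_)
    obtain ⟨p, hp⟩ := hconn.exists_walk_length_eq_dist y x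
    cases p with
    | nil => exact Set.mem_biUnion (x := x) (by simp) (Set.mem_insert _ _)
    | @cons _ z _ h p =>
      refine Set.mem_biUnion (x := z) ?_ (Set.mem_insert_of_mem _ h.symm)
      have h1 := dist_le p
      have h2 : G.dist x y ≤ R + 1 := hy
      rw [Walk.length_cons, dist_comm] at hp
      rw [Set.mem_ofPred_eq, dist_comm]
      omega

/-- Both `γ v` and `γ⁻¹ v` stay in finite balls, so along an ultrafilter each is eventually
constant. Tracking the inverses as well makes the pointwise limit surjective. -/
theorem isCompact_aut_apply_eq [G.LocallyFinite] (hconn : G.Connected) (y z : V) :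
    IsCompact {γ : G ≃g G | γ y = z} := by
  rw [isCompact_iff_ultrafilter_le_nhds]
  intro U hU
  rw [Filter.le_principal_iff] at hU
  have hconst : ∀ {f : (G ≃g G) → V} {s : Set V}, s.Finite → {γ | f γ ∈ s} ∈ U →
      ∃ w, {γ | f γ = w} ∈ U := by
    intro f s hs h
    have h' : (⋃ w ∈ s, {γ | f γ = w}) ∈ U :=
      Filter.mem_of_superset h fun γ hγ => Set.mem_biUnion hγ rfl
    obtain ⟨w, -, hw⟩ := (Ultrafilter.finite_biUnion_mem_iff hs).1 h'
    exact ⟨w, hw⟩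
  have h1 : ∀ v, ∃ w, {γ : G ≃g G | γ v = w} ∈ U := fun v =>
    hconst (hconn.finite_setOf_dist_le z (G.dist y v)) <| Filter.mem_of_superset hU fun γ hγ => by
      have hγ' : γ y = z := hγ
      rw [Set.mem_ofPred_eq, Set.mem_ofPred_eq, ← hγ', hconn.dist_aut]
  have h2 : ∀ v, ∃ w, {γ : G ≃g G | γ⁻¹ v = w} ∈ U := fun v =>
    hconst (hconn.finite_setOf_dist_le y (G.dist z v)) <| Filter.mem_of_superset hU fun γ hγ => by
      have hγ' : γ y = z := hγ
      rw [Set.mem_ofPred_eq, Set.mem_ofPred_eq, ← hconn.dist_aut γ, hγ', RelIso.apply_inv_self]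
  choose f hf using h1
  choose g hg using h2
  have hgf : ∀ v, g (f v) = v := by
    intro v
    obtain ⟨γ, hγ1, hγ2⟩ := U.nonempty_of_mem (Filter.inter_mem (hf v) (hg (f v)))
    rw [Set.mem_ofPred_eq] at hγ1 hγ2
    rw [← hγ2, ← hγ1, RelIso.inv_apply_self]
  have hfg : ∀ v, f (g v) = v := by
    intro v
    obtain ⟨γ, hγ1, hγ2⟩ := U.nonempty_of_mem (Filter.inter_mem (hg v) (hf (g v)))
    rw [Set.mem_ofPred_eq] at hγ1 hγ2
    rw [← hγ2, ← hγ1, RelIso.apply_inv_self]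
  have hadj : ∀ a b, G.Adj (f a) (f b) ↔ G.Adj a b := by
    intro a b
    obtain ⟨γ, hγ1, hγ2⟩ := U.nonempty_of_mem (Filter.inter_mem (hf a) (hf b))
    rw [Set.mem_ofPred_eq] at hγ1 hγ2
    rw [← hγ1, ← hγ2]
    exact γ.map_adj_iff
  let φ : G ≃g G := ⟨⟨f, g, hgf, hfg⟩, hadj _ _⟩
  refine ⟨φ, ?_, ?_⟩
  · obtain ⟨γ, hγ1, hγ2⟩ := U.nonempty_of_mem (Filter.inter_mem (hf y) hU)
    exact hγ1.symm.trans hγ2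
  · rw [nhds_iInf]
    refine le_iInf fun v => ?_
    let _ : TopologicalSpace V := ⊥
    have : DiscreteTopology V := ⟨rfl⟩
    rw [nhds_induced, nhds_discrete, Filter.comap_pure, Filter.le_principal_iff]
    exact hf v

instance aut_t2Space : T2Space (G ≃g G) := by
  refine ⟨fun γ δ hne => ?_⟩
  obtain ⟨x, hx⟩ : ∃ x, γ x ≠ δ x := by
    by_contra! h
    exact hne (RelIso.ext h)
  refine ⟨{α | α x = γ x}, {α | α x = δ x}, G.isOpen_aut_apply_eq _ _, G.isOpen_aut_apply_eq _ _,
    rfl, rfl, ?_⟩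
  rw [Set.disjoint_left]
  exact fun α h1 h2 => hx (h1.symm.trans h2)

theorem aut_locallyCompactSpace [G.LocallyFinite] (hconn : G.Connected) :
    LocallyCompactSpace (G ≃g G) := by
  obtain ⟨o⟩ := hconn.nonempty
  exact (G.isCompact_aut_apply_eq hconn o o).locallyCompactSpace_of_mem_nhds_of_group
    ((G.isOpen_aut_apply_eq o o).mem_nhds (x := 1) rfl)

theorem aut_exists_isCompact_closure_eq_top [G.LocallyFinite] (hconn : G.Connected)
    (hqt : G.IsQuasiTransitive) :
    ∃ K : Set (G ≃g G), IsCompact K ∧ Subgroup.closure K = ⊤ := by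
  obtain ⟨S, hS⟩ := hqt
  let K : Set (G ≃g G) :=
    ⋃ x ∈ S, ⋃ y ∈ S, ⋃ z ∈ {z | G.dist x z ≤ 1}, {γ | γ y = z}
  have hK : ∀ {γ : G ≃g G} {x y : V}, x ∈ S → y ∈ S → G.dist x (γ y) ≤ 1 → γ ∈ K := by
    intro γ x y hx hy h
    exact Set.mem_biUnion hx <| Set.mem_biUnion hy <| Set.mem_biUnion (x := γ y) h rfl
  refine ⟨K, ?_, ?_⟩
  · exact S.finite_toSet.isCompact_biUnion fun x _ => S.finite_toSet.isCompact_biUnion fun y _ =>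
      (hconn.finite_setOf_dist_le x 1).isCompact_biUnion fun z _ =>
        G.isCompact_aut_apply_eq hconn y z
  · obtain ⟨o₁⟩ := hconn.nonempty
    obtain ⟨-, o, ho, -⟩ := hS o₁
    -- Induct along a path from `o`: if `δ t = v` and `γ s = w` with `v`, `w` adjacent, then `δ⁻¹ *
    -- γ` moves `s` to a neighbour of `t`, hence lies in `K`.
    have key : ∀ v, ∀ γ : G ≃g G, ∀ s ∈ S, γ s = v → γ ∈ Subgroup.closure K := by
      intro v
      induction (reachable_iff_reflTransGen o v).1 (hconn o v) with
      | refl =>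
        intro γ s hs h
        exact Subgroup.subset_closure (hK ho hs (by rw [h, dist_self]; exact zero_le_one))
      | @tail v w _ hvw ih =>
        intro γ s hs h
        obtain ⟨δ, t, ht, rfl⟩ := hS v
        have h1 : δ⁻¹ * γ ∈ K := by
          refine hK ht hs ?_
          rw [← hconn.dist_aut δ, RelIso.mul_apply, RelIso.apply_inv_self, h]
          exact (dist_eq_one_iff_adj.2 hvw).le
        simpa using mul_mem (ih δ t ht rfl) (Subgroup.subset_closure h1)
    exact (Subgroup.eq_top_iff' _).2 fun γ => key (γ o) γ o ho rfl

end SimpleGraph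

/-- A compactly generated locally compact group is not an increasing union of compact proper
subgroups: by Baire's theorem these would eventually be open. -/
theorem not_exists_iUnion_isCompact_subgroup {Γ : Type*} [Group Γ] [TopologicalSpace Γ]
    [IsTopologicalGroup Γ] [T2Space Γ] [LocallyCompactSpace Γ] {K : Set Γ} (hK : IsCompact K)
    (hgen : Subgroup.closure K = ⊤) :
    ¬ ∃ H : ℕ → Subgroup Γ, Monotone H ∧ (∀ n, IsCompact (H n : Set Γ) ∧ H n ≠ ⊤) ∧
      (⋃ n, (H n : Set Γ)) = Set.univ := by
  rintro ⟨H, hmono, hH, hU⟩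
  obtain ⟨N, γ, hγ⟩ := nonempty_interior_of_iUnion_of_closed (fun n => (hH n).1.isClosed) hU
  have hopen : ∀ n, IsOpen (H (N + n) : Set Γ) := fun n =>
    Subgroup.isOpen_of_mem_nhds _ (Filter.mem_of_superset (mem_interior_iff_mem_nhds.1 hγ)
      (hmono (Nat.le_add_right N n)))
  -- The subgroups from `N` on are open and increasing, so a single one contains the compact
  -- generating set.
  obtain ⟨n, hn⟩ := hK.elim_directed_cover (fun n => (H (N + n) : Set Γ)) hopen
    (fun x _ => by
      obtain ⟨k, hk⟩ := Set.mem_iUnion.1 (hU.symm ▸ Set.mem_univ x : x ∈ ⋃ n, (H n : Set Γ))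
      exact Set.mem_iUnion.2 ⟨k, hmono (Nat.le_add_left k N) hk⟩)
    (Monotone.directed_le fun a b hab => hmono (Nat.add_le_add_left hab N))
  exact (hH (N + n)).2 (top_le_iff.1 (hgen ▸ (Subgroup.closure_le _).2 hn))

/-! ### Følner sets with small thick boundary. -/

theorem Set.ncard_biUnion_le_mul {α β : Type*} {T : Set α} (hT : T.Finite) {s : α → Set β}
    {C : ℕ} (hC : ∀ a ∈ T, (s a).ncard ≤ C) :
    (⋃ a ∈ T, s a).ncard ≤ T.ncard * C := by
  induction T, hT using Set.Finite.induction_on with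
  | empty => simp
  | @insert a T ha hT ih =>
    rw [Set.biUnion_insert, Set.ncard_insert_of_notMem ha hT, add_mul, one_mul, add_comm]
    refine (Set.ncard_union_le _ _).trans (add_le_add (hC a (Set.mem_insert _ _)) ?_)
    exact ih fun b hb => hC b (Set.mem_insert_of_mem _ hb)

namespace SimpleGraph

variable {V : Type*} (G : SimpleGraph V)

/-- The vertices of `W` at distance at most `R` from the complement of `W`. -/
def thickBoundary (R : ℕ) (W : Set V) : Set V :=
  {x | x ∈ W ∧ ∃ y, y ∉ W ∧ G.dist x y ≤ R}

/-- The orbit of a vertex under the automorphism group. -/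
def autOrbit (o : V) : Set V :=
  Set.range fun γ : G ≃g G => γ o

theorem thickBoundary_subset (R : ℕ) (W : Set V) : G.thickBoundary R W ⊆ W :=
  fun _ h => h.1

theorem autOrbit_apply (γ : G ≃g G) (o : V) : G.autOrbit (γ o) = G.autOrbit o := by
  ext x
  constructor
  · rintro ⟨δ, rfl⟩
    exact ⟨δ * γ, rfl⟩
  · rintro ⟨δ, rfl⟩
    exact ⟨δ * γ⁻¹, by simp [RelIso.mul_apply]⟩

variable {G}

/-- The vertex found is the one just before the walk first leaves `W`. -/
theorem Connected.exists_mem_innerBoundary_dist_le (hconn : G.Connected) {W : Set V} {x y : V}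
    (p : G.Walk x y) (hx : x ∈ W) (hy : y ∉ W) :
    ∃ b ∈ G.innerBoundary W, G.dist b x ≤ p.length := by
  induction p with
  | nil => exact absurd hx hy
  | @cons x z y h p ih =>
    by_cases hz : z ∈ W
    · obtain ⟨b, hb, hd⟩ := ih hz hy
      refine ⟨b, hb, (hconn.dist_triangle (v := z)).trans ?_⟩
      rw [Walk.length_cons, dist_eq_one_iff_adj.2 h.symm]
      exact Nat.add_le_add_right hd 1
    · exact ⟨x, ⟨hx, z, hz, h⟩, by simp⟩

theorem Connected.thickBoundary_subset_biUnion (hconn : G.Connected) (R : ℕ) (W : Set V) :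
    G.thickBoundary R W ⊆ ⋃ b ∈ G.innerBoundary W, {x | G.dist b x ≤ R} := by
  rintro x ⟨hx, y, hy, hd⟩
  obtain ⟨p, hp⟩ := hconn.exists_walk_length_eq_dist x y
  obtain ⟨b, hb, hbx⟩ := hconn.exists_mem_innerBoundary_dist_le p hx hy
  exact Set.mem_biUnion hb (hbx.trans (hp.le.trans hd))

theorem Connected.exists_ncard_setOf_dist_le [G.LocallyFinite] (hconn : G.Connected)
    (hqt : G.IsQuasiTransitive) (R : ℕ) :
    ∃ C : ℕ, ∀ x, {y | G.dist x y ≤ R}.ncard ≤ C := by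
  obtain ⟨S, hS⟩ := hqt
  refine ⟨S.sup fun x => {y | G.dist x y ≤ R}.ncard, fun x => ?_⟩
  obtain ⟨γ, s, hs, rfl⟩ := hS x
  refine le_trans ?_ (Finset.le_sup (f := fun x => {y | G.dist x y ≤ R}.ncard) hs)
  have : {y | G.dist (γ s) y ≤ R} = γ '' {y | G.dist s y ≤ R} := by
    ext y
    constructor
    · intro hy
      refine ⟨γ⁻¹ y, ?_, RelIso.apply_inv_self γ y⟩
      rwa [Set.mem_ofPred_eq, ← hconn.dist_aut γ, RelIso.apply_inv_self]
    · rintro ⟨z, hz, rfl⟩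
      rwa [Set.mem_ofPred_eq, hconn.dist_aut γ]
  rw [this, Set.ncard_image_of_injective _ γ.injective]

theorem Connected.exists_dist_autOrbit_le (hconn : G.Connected) (hqt : G.IsQuasiTransitive)
    (o : V) : ∃ D : ℕ, ∀ x, ∃ y ∈ G.autOrbit o, G.dist x y ≤ D := by
  obtain ⟨S, hS⟩ := hqt
  refine ⟨S.sup fun s => G.dist s o, fun x => ?_⟩
  obtain ⟨γ, s, hs, rfl⟩ := hS x
  refine ⟨γ o, ⟨γ, rfl⟩, ?_⟩
  rw [hconn.dist_aut]
  exact Finset.le_sup (f := fun s => G.dist s o) hs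

theorem IsAmenable.exists_innerBoundary_le (ham : G.IsAmenable) {ε : ℝ} (hε : 0 < ε) :
    ∃ W : Finset V, W.Nonempty ∧ ((G.innerBoundary (W : Set V)).ncard : ℝ) ≤ ε * W.card := by
  have := ham.infinite
  obtain ⟨x⟩ : Nonempty V := inferInstance
  have : Nonempty {W : Finset V // W.Nonempty} := ⟨⟨{x}, Finset.singleton_nonempty x⟩⟩
  obtain ⟨⟨W, hW⟩, hlt⟩ := exists_lt_of_ciInf_lt (ham.iInf_eq_zero.trans_lt hε)
  refine ⟨W, hW, ?_⟩
  exact ((div_lt_iff₀ (by exact_mod_cast hW.card_pos)).1 hlt).le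

/-- In an amenable quasi-transitive graph there are finite sets of vertices whose thick boundary is
small even when compared with the part of the set in a given orbit. -/
theorem Connected.exists_thickBoundary_le [G.LocallyFinite] (hconn : G.Connected)
    (hqt : G.IsQuasiTransitive) (ham : G.IsAmenable) (o : V) (R : ℕ) {ε : ℝ} (hε : 0 < ε) :
    ∃ W : Finset V, 0 < ((W : Set V) ∩ G.autOrbit o).ncard ∧
      ((G.thickBoundary R (W : Set V)).ncard : ℝ) ≤ ε * ((W : Set V) ∩ G.autOrbit o).ncard := by
  obtain ⟨D, hD⟩ := hconn.exists_dist_autOrbit_le hqt o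
  obtain ⟨C, hC⟩ := hconn.exists_ncard_setOf_dist_le hqt D
  obtain ⟨B, hB⟩ := hconn.exists_ncard_setOf_dist_le hqt R
  -- The first bound makes the `D`-thick boundary at most half of `W`, so the orbit of `o` fills at
  -- least a fraction `1 / (2 * (C + 1))` of `W`; the second turns smallness relative to `W` into
  -- smallness relative to that orbit part. The `+ 1`s keep the denominators positive.
  set δ : ℝ := min (1 / (2 * (C + 1))) (ε / (2 * (B + 1) * (C + 1))) with hδ
  have hδ0 : 0 < δ := lt_min (by positivity) (by positivity)
  obtain ⟨W, hW, hWδ⟩ := ham.exists_innerBoundary_le hδ0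
  have hfin : (G.innerBoundary (W : Set V)).Finite := W.finite_toSet.subset fun x hx => hx.1
  have hthick : ∀ (r A : ℕ), (∀ x, {y | G.dist x y ≤ r}.ncard ≤ A) →
      (G.thickBoundary r (W : Set V)).ncard ≤ (G.innerBoundary (W : Set V)).ncard * A := by
    intro r A hA
    refine (Set.ncard_le_ncard (hconn.thickBoundary_subset_biUnion r W)
      (hfin.biUnion fun b _ => hconn.finite_setOf_dist_le b r)).trans ?_
    exact Set.ncard_biUnion_le_mul hfin fun b _ => hA b
  have hOfin : ((W : Set V) ∩ G.autOrbit o).Finite := W.finite_toSet.inter_of_left _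
  have hcover : W.card ≤ (G.thickBoundary D (W : Set V)).ncard +
      ((W : Set V) ∩ G.autOrbit o).ncard * C := by
    -- Each vertex of `W` has an orbit point within `D`; if that point is outside `W`, the vertex is
    -- in the thick boundary.
    have hsub : (W : Set V) ⊆ G.thickBoundary D (W : Set V) ∪
        ⋃ y ∈ (W : Set V) ∩ G.autOrbit o, {x | G.dist y x ≤ D} := by
      intro x hx
      obtain ⟨y, hy, hxy⟩ := hD x
      by_cases hyW : y ∈ (W : Set V)
      · refine Or.inr (Set.mem_biUnion (x := y) ⟨hyW, hy⟩ ?_)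
        rwa [Set.mem_ofPred_eq, dist_comm]
      · exact Or.inl ⟨hx, y, hyW, hxy⟩
    rw [← Set.ncard_coe_finset W]
    refine (Set.ncard_le_ncard hsub ((W.finite_toSet.subset (G.thickBoundary_subset D _)).union
      (hOfin.biUnion fun b _ => hconn.finite_setOf_dist_le b D))).trans ?_
    refine (Set.ncard_union_le _ _).trans (Nat.add_le_add_left ?_ _)
    exact Set.ncard_biUnion_le_mul hOfin fun b _ => hC b
  have h1 : (W.card : ℝ) ≤ (G.innerBoundary (W : Set V)).ncard * C +
      ((W : Set V) ∩ G.autOrbit o).ncard * C := by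
    exact_mod_cast hcover.trans (Nat.add_le_add_right (hthick D C hC) _)
  have h2 : ((G.thickBoundary R (W : Set V)).ncard : ℝ) ≤
      (G.innerBoundary (W : Set V)).ncard * B := by
    exact_mod_cast hthick R B hB
  have hW0 : (0 : ℝ) < W.card := by exact_mod_cast hW.card_pos
  generalize (W.card : ℝ) = w at *
  generalize ((G.innerBoundary (W : Set V)).ncard : ℝ) = b at *
  have hu : (0 : ℝ) ≤ ((W : Set V) ∩ G.autOrbit o).ncard := Nat.cast_nonneg _
  have hδ1 : δ * (C + 1) ≤ 1 / 2 := by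
    calc δ * (C + 1) ≤ 1 / (2 * (C + 1)) * (C + 1) := by gcongr; exact min_le_left _ _
      _ = 1 / 2 := by field_simp
  have hδ2 : δ * (2 * (B + 1) * (C + 1)) ≤ ε := (le_div_iff₀ (by positivity)).1 (min_le_right _ _)
  have h3 : w ≤ 2 * (C + 1) * ((W : Set V) ∩ G.autOrbit o).ncard := by
    have : b * C ≤ w / 2 := by
      calc b * C ≤ (δ * w) * (C + 1) := by gcongr; linarith
        _ = (δ * (C + 1)) * w := by ring
        _ ≤ 1 / 2 * w := by gcongr
        _ = w / 2 := by ring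
    nlinarith
  refine ⟨W, ?_, ?_⟩
  · by_contra h
    have h0 : ((W : Set V) ∩ G.autOrbit o).ncard = 0 := by omega
    rw [h0] at h3
    simp at h3
    linarith
  · calc ((G.thickBoundary R (W : Set V)).ncard : ℝ) ≤ b * B := h2
      _ ≤ (δ * w) * (B + 1) := by gcongr; linarith
      _ ≤ (δ * (2 * (C + 1) * ((W : Set V) ∩ G.autOrbit o).ncard)) * (B + 1) := by gcongr
      _ = δ * (2 * (B + 1) * (C + 1)) * ((W : Set V) ∩ G.autOrbit o).ncard := by ring
      _ ≤ ε * ((W : Set V) ∩ G.autOrbit o).ncard := by gcongr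

end SimpleGraph

/-! ### Haar measure of sets of automorphisms, and unimodularity. -/

/-- If the fibres of `φ` over the points of `O` have measure `c` and the other fibres are empty,
then the preimage of a finite set `T` has measure `|T ∩ O| * c`. -/
theorem measureReal_preimage_finite_eq_ncard_mul {α β : Type*} [MeasurableSpace α] {μ : Measure α}
    {φ : α → β} {O : Set β} {c : ℝ} (hmeas : ∀ w, MeasurableSet {a | φ a = w})
    (hfin : ∀ w, μ {a | φ a = w} ≠ ∞) (hO : ∀ a, φ a ∈ O)
    (hc : ∀ w ∈ O, μ.real {a | φ a = w} = c) {T : Set β} (hT : T.Finite) :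
    μ.real {a | φ a ∈ T} = (T ∩ O).ncard * c := by
  have hTO : (T ∩ O).Finite := hT.inter_of_left O
  have heq : {a | φ a ∈ T} = ⋃ w ∈ hTO.toFinset, {a | φ a = w} := by
    ext a
    simp [hO a]
  rw [heq, measureReal_biUnion_finset _ (fun w _ => hmeas w) (fun w _ => hfin w),
    Finset.sum_congr rfl (fun w hw => hc w (hTO.mem_toFinset.1 hw).2), Finset.sum_const,
    nsmul_eq_mul, Set.ncard_eq_toFinset_card _ hTO]
  intro w _ w' _ hne
  exact Set.disjoint_left.2 fun a h1 h2 => hne (h1.symm.trans h2)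

namespace SimpleGraph

variable {V : Type*} {G : SimpleGraph V}

section Haar

variable (μ : Measure (G ≃g G))

theorem measurableSet_aut_apply_eq (x y : V) : MeasurableSet {γ : G ≃g G | γ x = y} :=
  (G.isOpen_aut_apply_eq x y).measurableSet

theorem setOf_inv_apply_eq (x y : V) : {γ : G ≃g G | γ⁻¹ x = y} = {γ : G ≃g G | γ y = x} := by
  ext γ
  constructor
  · rintro rfl
    exact RelIso.apply_inv_self γ x
  · rintro rfl
    exact RelIso.inv_apply_self γ y

theorem Connected.measure_aut_apply_eq_ne_top [G.LocallyFinite] (hconn : G.Connected)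
    [IsFiniteMeasureOnCompacts μ] (x y : V) : μ {γ : G ≃g G | γ x = y} ≠ ∞ :=
  (G.isCompact_aut_apply_eq hconn x y).measure_ne_top

theorem Connected.measureReal_stabilizer_pos [G.LocallyFinite] (hconn : G.Connected)
    [μ.IsHaarMeasure] (x : V) : 0 < μ.real {γ : G ≃g G | γ x = x} :=
  ENNReal.toReal_pos ((G.isOpen_aut_apply_eq x x).measure_pos μ ⟨1, rfl⟩).ne'
    (hconn.measure_aut_apply_eq_ne_top μ x x)

/-- The measure of the set of automorphisms that map `x` into a finite set. -/
theorem Connected.measureReal_apply_mem [G.LocallyFinite] (hconn : G.Connected)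
    [μ.IsHaarMeasure] (x : V) {T : Set V} (hT : T.Finite) :
    μ.real {γ : G ≃g G | γ x ∈ T} =
      (T ∩ G.autOrbit x).ncard * μ.real {γ : G ≃g G | γ x = x} := by
  refine measureReal_preimage_finite_eq_ncard_mul (φ := fun γ : G ≃g G => γ x)
    (O := G.autOrbit x) (fun w => measurableSet_aut_apply_eq x w)
    (fun w => hconn.measure_aut_apply_eq_ne_top μ x w) (fun γ => ⟨γ, rfl⟩) ?_ hT
  rintro _ ⟨δ, rfl⟩
  -- This fibre is the left coset of the stabilizer by `δ`.
  have : {γ : G ≃g G | γ x = δ x} = (fun γ => δ⁻¹ * γ) ⁻¹' {γ | γ x = x} := by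
    ext γ
    simp only [Set.mem_ofPred_eq, Set.mem_preimage, RelIso.mul_apply]
    rw [← δ.injective.eq_iff (a := δ⁻¹ (γ x)), RelIso.apply_inv_self]
  rw [this, measureReal_def, measure_preimage_mul, measureReal_def]

/-- The measure of the set of automorphisms whose inverse maps `x` into a finite set. -/
theorem Connected.measureReal_inv_apply_mem [G.LocallyFinite] (hconn : G.Connected)
    [μ.IsHaarMeasure] [μ.IsMulRightInvariant] (x : V) {T : Set V} (hT : T.Finite) :
    μ.real {γ : G ≃g G | γ⁻¹ x ∈ T} =
      (T ∩ G.autOrbit x).ncard * μ.real {γ : G ≃g G | γ x = x} := by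
  refine measureReal_preimage_finite_eq_ncard_mul (φ := fun γ : G ≃g G => γ⁻¹ x)
    (O := G.autOrbit x) (fun w => ?_) (fun w => ?_) (fun γ => ⟨γ⁻¹, rfl⟩) ?_ hT
  · rw [setOf_inv_apply_eq]
    exact measurableSet_aut_apply_eq w x
  · rw [setOf_inv_apply_eq]
    exact hconn.measure_aut_apply_eq_ne_top μ w x
  · rintro _ ⟨δ, rfl⟩
    -- Inversion turns the fibre into a right coset, hence the need for right invariance.
    have : {γ : G ≃g G | γ⁻¹ x = δ x} = (fun γ => γ * δ) ⁻¹' {γ | γ x = x} := by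
      rw [setOf_inv_apply_eq]
      rfl
    rw [this, measureReal_def, measure_preimage_mul_right, measureReal_def]

/-- Compare the automorphisms taking `o` into a Følner set `W` with those taking `δ o` into `W`. The
excess sends `o` into the thick boundary of radius `dist o (δ o)`. As `o` and `δ o` share an orbit,
the factor `|W ∩ orbit o|` cancels. -/
theorem measureReal_stabilizer_le [G.LocallyFinite] (hconn : G.Connected)
    (hqt : G.IsQuasiTransitive) (ham : G.IsAmenable) [μ.IsHaarMeasure] (δ : G ≃g G) (o : V) :
    μ.real {γ : G ≃g G | γ o = o} ≤ μ.real {γ : G ≃g G | γ (δ o) = δ o} := by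
  have hc := hconn.measureReal_stabilizer_pos μ o
  refine le_of_forall_pos_le_add fun ε hε => ?_
  obtain ⟨W, hW, hWε⟩ := hconn.exists_thickBoundary_le hqt ham o (G.dist o (δ o))
    (div_pos hε hc)
  have hTfin : (G.thickBoundary (G.dist o (δ o)) (W : Set V)).Finite :=
    W.finite_toSet.subset (G.thickBoundary_subset _ _)
  have hsub : {γ : G ≃g G | γ o ∈ (W : Set V)} ⊆ {γ : G ≃g G | γ (δ o) ∈ (W : Set V)} ∪
      {γ : G ≃g G | γ o ∈ G.thickBoundary (G.dist o (δ o)) (W : Set V)} := by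
    intro γ hγ
    by_cases h : γ (δ o) ∈ (W : Set V)
    · exact Or.inl h
    · exact Or.inr ⟨hγ, _, h, (hconn.dist_aut γ _ _).le⟩
  have hfin : ∀ (x : V) {T : Set V}, T.Finite → μ {γ : G ≃g G | γ x ∈ T} ≠ ∞ := by
    intro x T hT
    have : {γ : G ≃g G | γ x ∈ T} = ⋃ w ∈ T, {γ : G ≃g G | γ x = w} := by
      ext γ
      simp
    rw [this]
    exact (hT.isCompact_biUnion fun w _ => G.isCompact_aut_apply_eq hconn x w).measure_ne_top
  have h1 := (measureReal_mono hsub (measure_union_ne_top (hfin _ W.finite_toSet)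
    (hfin _ hTfin))).trans (measureReal_union_le _ _)
  rw [hconn.measureReal_apply_mem μ _ W.finite_toSet, hconn.measureReal_apply_mem μ _ hTfin,
    hconn.measureReal_apply_mem μ _ W.finite_toSet, G.autOrbit_apply] at h1
  have h2 : ((G.thickBoundary (G.dist o (δ o)) (W : Set V) ∩ G.autOrbit o).ncard : ℝ) ≤
      (G.thickBoundary (G.dist o (δ o)) (W : Set V)).ncard := by
    exact_mod_cast Set.ncard_le_ncard Set.inter_subset_left hTfin
  have hW' : (0 : ℝ) < ((W : Set V) ∩ G.autOrbit o).ncard := by exact_mod_cast hW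
  refine le_of_mul_le_mul_left (h1.trans ?_) hW'
  rw [mul_add]
  refine add_le_add le_rfl ?_
  calc _ ≤ (ε / μ.real {γ : G ≃g G | γ o = o} * ((W : Set V) ∩ G.autOrbit o).ncard) *
        μ.real {γ : G ≃g G | γ o = o} := by gcongr; exact h2.trans hWε
    _ = ((W : Set V) ∩ G.autOrbit o).ncard * ε := by field_simp

theorem measureReal_stabilizer_eq [G.LocallyFinite] (hconn : G.Connected)
    (hqt : G.IsQuasiTransitive) (ham : G.IsAmenable) [μ.IsHaarMeasure] (δ : G ≃g G) (o : V) :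
    μ.real {γ : G ≃g G | γ (δ o) = δ o} = μ.real {γ : G ≃g G | γ o = o} := by
  refine le_antisymm ?_ (measureReal_stabilizer_le μ hconn hqt ham δ o)
  simpa [RelIso.inv_apply_self] using measureReal_stabilizer_le μ hconn hqt ham δ⁻¹ (δ o)

end Haar

/-- A right translate of `μ` is a multiple of `μ` by uniqueness of Haar measure. Evaluating on the
stabilizer of `o`, whose preimage is a left translate of the stabilizer of `δ o`, shows that the
factor is `1`. -/
theorem aut_isUnimodularGroup [G.LocallyFinite] (hconn : G.Connected)
    (hqt : G.IsQuasiTransitive) (ham : G.IsAmenable) : IsUnimodularGroup (G ≃g G) := by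
  have := G.aut_locallyCompactSpace hconn
  refine ⟨inferInstance, fun μ _ _ => ⟨fun δ => ?_⟩⟩
  obtain ⟨o⟩ := hconn.nonempty
  have hreg : (μ.map (· * δ)).Regular := Measure.Regular.map (Homeomorph.mulRight δ)
  have hsmul := Measure.isMulLeftInvariant_eq_smul_of_regular (μ.map (· * δ)) μ
  set c := Measure.haarScalarFactor (μ.map (· * δ)) μ
  have hpre : (· * δ) ⁻¹' {γ : G ≃g G | γ o = o} =
      (δ * ·) ⁻¹' {γ : G ≃g G | γ (δ o) = δ o} := by
    ext γ
    simp [RelIso.mul_apply]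
  have hmap : (μ.map (· * δ)).real {γ : G ≃g G | γ o = o} = μ.real {γ : G ≃g G | γ o = o} := by
    rw [measureReal_def, Measure.map_apply (measurable_mul_const δ)
      (measurableSet_aut_apply_eq o o), hpre, measure_preimage_mul, ← measureReal_def,
      measureReal_stabilizer_eq μ hconn hqt ham]
  have hc : (c : ℝ) = 1 := by
    rw [hsmul, measureReal_nnreal_smul_apply] at hmap
    exact (mul_eq_right₀ (hconn.measureReal_stabilizer_pos μ o).ne').1 hmap
  rw [hsmul, NNReal.coe_eq_one.1 hc, one_smul]

end SimpleGraph

/-! ### From Følner sequences to invariant means. -/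

open Filter Topology in
/-- The limit along an ultrafilter of a bounded sequence of linear functionals. -/
theorem exists_linearMap_tendsto_ultrafilter {E ι : Type*} [AddCommGroup E] [Module ℝ E]
    (U : Ultrafilter ι) (a : ι → E →ₗ[ℝ] ℝ) (hbdd : ∀ f, ∃ C, ∀ i, |a i f| ≤ C) :
    ∃ m : E →ₗ[ℝ] ℝ, ∀ f, Tendsto (fun i => a i f) U (𝓝 (m f)) := by
  have hlim : ∀ f, ∃ l, Tendsto (fun i => a i f) U (𝓝 l) := by
    intro f
    obtain ⟨C, hC⟩ := hbdd f
    obtain ⟨l, -, hl⟩ := isCompact_iff_ultrafilter_le_nhds.1 (isCompact_Icc (a := -C) (b := C))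
      (U.map fun i => a i f)
      (le_principal_iff.2 (mem_map.2 (Eventually.of_forall fun i => abs_le.1 (hC i))))
    exact ⟨l, hl⟩
  choose m hm using hlim
  refine ⟨⟨⟨m, fun f g => ?_⟩, fun c f => ?_⟩, hm⟩
  · refine tendsto_nhds_unique (hm (f + g)) ?_
    simpa using (hm f).add (hm g)
  · refine tendsto_nhds_unique (hm (c • f)) ?_
    simpa using (hm f).const_mul c

section Averages

variable {α : Type*} [MeasurableSpace α] {μ : Measure α}

theorem MeasureTheory.Lp.ae_norm_le_norm_top (f : Lp ℝ ∞ μ) : ∀ᵐ x ∂μ, ‖f x‖ ≤ ‖f‖ := by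
  filter_upwards [enorm_ae_le_eLpNormEssSup f μ] with x hx
  rw [Lp.norm_def, eLpNorm_exponent_top, ← toReal_enorm]
  refine ENNReal.toReal_mono ?_ hx
  rw [← eLpNorm_exponent_top]
  exact Lp.eLpNorm_ne_top f

theorem MeasureTheory.Lp.integrableOn_of_measure_ne_top (f : Lp ℝ ∞ μ) {s : Set α}
    (hs : μ s ≠ ∞) : IntegrableOn f s μ := by
  have : IsFiniteMeasure (μ.restrict s) := ⟨by simpa using hs.lt_top⟩
  exact ((Lp.memLp f).restrict s).integrable le_top

theorem MeasureTheory.Lp.abs_setIntegral_le (f : Lp ℝ ∞ μ) {s : Set α} (hs : μ s ≠ ∞) :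
    |∫ x in s, f x ∂μ| ≤ ‖f‖ * μ.real s :=
  norm_setIntegral_le_of_norm_le_const_ae hs.lt_top
    (ae_restrict_of_ae (Lp.ae_norm_le_norm_top f))

theorem MeasureTheory.Lp.abs_setIntegral_sub_le (f : Lp ℝ ∞ μ) {s t : Set α}
    (hs : MeasurableSet s) (ht : MeasurableSet t) (hsf : μ s ≠ ∞) (htf : μ t ≠ ∞) :
    |(∫ x in s, f x ∂μ) - ∫ x in t, f x ∂μ| ≤ ‖f‖ * (μ.real (s \ t) + μ.real (t \ s)) := by
  have h1 := integral_inter_add_sdiff ht (Lp.integrableOn_of_measure_ne_top f hsf)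
  have h2 := integral_inter_add_sdiff hs (Lp.integrableOn_of_measure_ne_top f htf)
  rw [Set.inter_comm] at h2
  have h3 := Lp.abs_setIntegral_le f (measure_ne_top_of_subset Set.sdiff_subset hsf : μ (s \ t) ≠ ∞)
  have h4 := Lp.abs_setIntegral_le f (measure_ne_top_of_subset Set.sdiff_subset htf : μ (t \ s) ≠ ∞)
  rw [← h1, ← h2, add_sub_add_left_eq_sub, mul_add]
  exact (abs_sub _ _).trans (add_le_add h3 h4)

/-- The average of a bounded function over a set of finite measure. -/
noncomputable def setAverageLp (μ : Measure α) (s : Set α) (hs : μ s ≠ ∞) :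
    Lp ℝ ∞ μ →ₗ[ℝ] ℝ where
  toFun f := (μ.real s)⁻¹ * ∫ x in s, f x ∂μ
  map_add' f g := by
    rw [← mul_add, ← integral_add (Lp.integrableOn_of_measure_ne_top f hs)
      (Lp.integrableOn_of_measure_ne_top g hs)]
    congr 1
    exact integral_congr_ae (ae_restrict_of_ae (Lp.coeFn_add f g))
  map_smul' c f := by
    rw [RingHom.id_apply, smul_eq_mul, mul_left_comm, ← integral_const_mul c]
    congr 1
    exact integral_congr_ae (ae_restrict_of_ae (Lp.coeFn_smul c f))

theorem setAverageLp_apply {s : Set α} (hs : μ s ≠ ∞) (f : Lp ℝ ∞ μ) :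
    setAverageLp μ s hs f = (μ.real s)⁻¹ * ∫ x in s, f x ∂μ :=
  rfl

end Averages

open Filter Topology in
/-- A Følner sequence gives a left-invariant mean. -/
theorem exists_isLeftInvariantMean_of_folner {Γ : Type*} [Group Γ] [TopologicalSpace Γ]
    [IsTopologicalGroup Γ] [MeasurableSpace Γ] [BorelSpace Γ] (μ : Measure Γ)
    [μ.IsMulLeftInvariant] (F : ℕ → Set Γ) (hmeas : ∀ n, MeasurableSet (F n))
    (hfin : ∀ n, μ (F n) ≠ ∞) (hpos : ∀ n, 0 < μ.real (F n))
    (hF : ∀ g : Γ, Tendsto (fun n => (μ.real (F n))⁻¹ *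
      (μ.real (((g⁻¹ * ·) ⁻¹' F n) \ F n) + μ.real (F n \ ((g⁻¹ * ·) ⁻¹' F n)))) atTop (𝓝 0)) :
    ∃ m : Lp ℝ ∞ μ →ₗ[ℝ] ℝ, IsLeftInvariantMean μ m := by
  obtain ⟨m, hm⟩ := exists_linearMap_tendsto_ultrafilter (hyperfilter ℕ)
    (fun n => setAverageLp μ (F n) (hfin n)) (fun f => ⟨‖f‖, fun n => by
      rw [setAverageLp_apply, abs_mul, abs_of_pos (inv_pos.2 (hpos n)), inv_mul_le_iff₀ (hpos n),
        mul_comm]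
      exact Lp.abs_setIntegral_le f (hfin n)⟩)
  have hU : (hyperfilter ℕ : Filter ℕ) ≤ atTop := by
    rw [← Nat.cofinite_eq_atTop]
    exact hyperfilter_le_cofinite
  refine ⟨m, fun f hf => ?_, ?_, fun g f => ?_⟩
  · refine ge_of_tendsto' (hm f) fun n => ?_
    exact mul_nonneg (inv_nonneg.2 measureReal_nonneg)
      (setIntegral_nonneg_of_ae ((Lp.coeFn_nonneg f).2 hf))
  · refine tendsto_nhds_unique (hm _) (tendsto_const_nhds.congr fun n => ?_)
    rw [setAverageLp_apply,
      integral_congr_ae (ae_restrict_of_ae (MemLp.coeFn_toLp (memLp_top_const (1 : ℝ)))),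
      setIntegral_const, smul_eq_mul, mul_one, inv_mul_cancel₀ (hpos n).ne']
  · refine tendsto_nhds_unique (hm _) ?_
    have hdiff : Tendsto (fun n => setAverageLp μ (F n) (hfin n) (DomMulAct.mk g • f) -
        setAverageLp μ (F n) (hfin n) f) atTop (𝓝 0) := by
      refine squeeze_zero_norm (fun n => ?_) (by simpa using (hF g).const_mul ‖f‖)
      -- Averaging the translate of `f` over `F n` amounts to integrating `f` over `g F n`, so the
      -- two averages differ only on the symmetric difference.
      have htr : ∫ x in F n, (DomMulAct.mk g • f) x ∂μ = ∫ x in (g⁻¹ * ·) ⁻¹' F n, f x ∂μ := by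
        rw [integral_congr_ae (ae_restrict_of_ae (DomMulAct.smul_Lp_ae_eq (DomMulAct.mk g) f)),
          ← (measurePreserving_mul_left μ g).setIntegral_preimage_emb
            (measurableEmbedding_mulLeft g) f, ← Set.preimage_comp]
        simp [Function.comp_def]
      rw [setAverageLp_apply, setAverageLp_apply, htr, ← mul_sub, norm_mul, Real.norm_eq_abs,
        abs_of_pos (inv_pos.2 (hpos n)), mul_left_comm]
      refine mul_le_mul_of_nonneg_left ?_ (inv_nonneg.2 measureReal_nonneg)
      refine Lp.abs_setIntegral_sub_le f (measurable_const_mul g⁻¹ (hmeas n)) (hmeas n) ?_ (hfin n)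
      rw [measure_preimage_mul]
      exact hfin n
    simpa using (hdiff.mono_left hU).add (hm f)

/-! ### Amenability of the automorphism group. -/

namespace SimpleGraph

variable {V : Type*} {G : SimpleGraph V}

open Filter Topology in
theorem aut_isAmenableGroup [G.LocallyFinite] (hconn : G.Connected)
    (hqt : G.IsQuasiTransitive) (ham : G.IsAmenable) : IsAmenableGroup (G ≃g G) := by
  refine ⟨G.aut_locallyCompactSpace hconn, fun μ _ _ => ?_⟩
  have := (aut_isUnimodularGroup hconn hqt ham).right_invariant μ
  obtain ⟨o⟩ := hconn.nonempty
  -- The radius grows with `n` while the tolerance `1 / (n + 1)` shrinks, so one sequence serves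
  -- every `δ` once `n ≥ dist o (δ o)`.
  choose W hW hWb using fun n : ℕ =>
    hconn.exists_thickBoundary_le hqt ham o n (Nat.one_div_pos_of_nat (α := ℝ) (n := n))
  have hc := hconn.measureReal_stabilizer_pos μ o
  have hmeasure := fun (x : V) {T : Set V} (hT : T.Finite) =>
    hconn.measureReal_inv_apply_mem μ x hT
  have hfin : ∀ (x : V) {T : Set V}, T.Finite → μ {γ : G ≃g G | γ⁻¹ x ∈ T} ≠ ∞ := by
    intro x T hT
    have : {γ : G ≃g G | γ⁻¹ x ∈ T} = ⋃ w ∈ T, {γ : G ≃g G | γ w = x} := by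
      ext γ
      simp [← setOf_inv_apply_eq]
    rw [this]
    exact (hT.isCompact_biUnion fun w _ => G.isCompact_aut_apply_eq hconn w x).measure_ne_top
  have hopen : ∀ (x : V) (T : Set V), IsOpen {γ : G ≃g G | γ⁻¹ x ∈ T} := by
    intro x T
    have : {γ : G ≃g G | γ⁻¹ x ∈ T} = ⋃ w ∈ T, {γ : G ≃g G | γ w = x} := by
      ext γ
      simp [← setOf_inv_apply_eq]
    rw [this]
    exact isOpen_biUnion fun w _ => G.isOpen_aut_apply_eq w x
  refine exists_isLeftInvariantMean_of_folner μ (fun n => {γ : G ≃g G | γ⁻¹ o ∈ (W n : Set V)})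
    (fun n => (hopen o _).measurableSet) (fun n => hfin o (W n).finite_toSet) (fun n => ?_)
    fun δ => ?_
  · rw [hmeasure o (W n).finite_toSet]
    exact mul_pos (by exact_mod_cast hW n) hc
  have hpre : ∀ T : Set V, (δ⁻¹ * ·) ⁻¹' {γ : G ≃g G | γ⁻¹ o ∈ T} =
      {γ : G ≃g G | γ⁻¹ (δ o) ∈ T} := by
    intro T
    ext γ
    simp [RelIso.mul_apply]
  -- Used for `(δ o, o)` and `(o, δ o)`, the two halves of the symmetric difference.
  have hthick : ∀ n ≥ G.dist o (δ o), ∀ x ∈ G.autOrbit o, ∀ y, G.dist x y = G.dist o (δ o) →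
      μ.real ({γ : G ≃g G | γ⁻¹ x ∈ (W n : Set V)} \ {γ : G ≃g G | γ⁻¹ y ∈ (W n : Set V)}) ≤
        1 / ((n : ℝ) + 1) * μ.real {γ : G ≃g G | γ⁻¹ o ∈ (W n : Set V)} := by
    rintro n hn _ ⟨α, rfl⟩ y hxy
    have hTfin : (G.thickBoundary n (W n : Set V)).Finite :=
      (W n).finite_toSet.subset (G.thickBoundary_subset _ _)
    have hsub : {γ : G ≃g G | γ⁻¹ (α o) ∈ (W n : Set V)} \
        {γ : G ≃g G | γ⁻¹ y ∈ (W n : Set V)} ⊆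
          {γ : G ≃g G | γ⁻¹ (α o) ∈ G.thickBoundary n (W n : Set V)} := fun γ hγ =>
      ⟨hγ.1, _, hγ.2, (hconn.dist_aut γ⁻¹ _ _).le.trans (hxy.le.trans hn)⟩
    refine (measureReal_mono hsub (hfin _ hTfin)).trans ?_
    rw [hmeasure _ hTfin, hmeasure _ (W n).finite_toSet, G.autOrbit_apply,
      measureReal_stabilizer_eq μ hconn hqt ham, ← mul_assoc]
    refine mul_le_mul_of_nonneg_right (le_trans ?_ (hWb n)) hc.le
    exact_mod_cast Set.ncard_le_ncard Set.inter_subset_left hTfin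
  have hlim : Tendsto (fun n : ℕ => 2 * (1 / ((n : ℝ) + 1))) atTop (𝓝 0) := by
    simpa using (tendsto_one_div_add_atTop_nhds_zero_nat (𝕜 := ℝ)).const_mul 2
  refine squeeze_zero' (Eventually.of_forall fun n => by positivity) ?_ hlim
  filter_upwards [eventually_ge_atTop (G.dist o (δ o))] with n hn
  have hposn : 0 < μ.real {γ : G ≃g G | γ⁻¹ o ∈ (W n : Set V)} := by
    rw [hmeasure o (W n).finite_toSet]
    exact mul_pos (by exact_mod_cast hW n) hc
  rw [hpre, inv_mul_le_iff₀ hposn]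
  have h1 := hthick n hn (δ o) ⟨δ, rfl⟩ o dist_comm
  have h2 := hthick n hn o ⟨1, rfl⟩ (δ o) rfl
  linarith

end SimpleGraph

theorem lemmal {V : Type*} (G : SimpleGraph V) [G.LocallyFinite] (hconn : G.Connected)
    (hqt : G.IsQuasiTransitive) (ham : G.IsAmenable) :
    IsAmenableGroup (G ≃g G) ∧
    IsUnimodularGroup (G ≃g G) ∧
    (∃ K : Set (G ≃g G), IsCompact K ∧ Subgroup.closure K = ⊤) ∧
    ¬ ∃ H : ℕ → Subgroup (G ≃g G), Monotone H ∧
      (∀ n, IsCompact (H n : Set (G ≃g G)) ∧ H n ≠ ⊤) ∧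
      (⋃ n, (H n : Set (G ≃g G))) = Set.univ := by
  have := G.aut_locallyCompactSpace hconn
  obtain ⟨K, hK, hgen⟩ := G.aut_exists_isCompact_closure_eq_top hconn hqt
  exact ⟨SimpleGraph.aut_isAmenableGroup hconn hqt ham,
    SimpleGraph.aut_isUnimodularGroup hconn hqt ham, ⟨K, hK, hgen⟩,
    not_exists_iUnion_isCompact_subgroup hK hgen⟩
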